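/- Let $\mathbf{x}=(x_i)_{i\in\mathbb{Z}}$ be commuting variables. An $\mathbb{N}$-vector is a sequence $\mathbf{c}=(c_i)_{i\in\mathbb{Z}}$ of nonnegative integers with finite support. Let $\overline{\mathbb{Z}}$ be the alphabet of letters $i^{(j)}$, $i\in\mathbb{Z}$, $j\in\mathbb{Z}_{>0}$, ordered lexicographically by $(i,j)$, with $\mathrm{val}(i^{(j)})=i$. For an $\mathbb{N}$-vector $\mathbf{c}$ let $W_{\mathbf{c}}=a_1a_2\cdots a_r$, $r=\sum_i c_i$, be the word consisting of all letters $i^{(j)}$ with $1\le j\le c_i$, written with decreasing $i$, and with increasing $j$ for fixed $i$. The back stable slide indexed by $\mathbf{c}$ is the formal power series \[ \overleftarrow{\mathfrak{F}}_{\mathbf{c}}=\sum_{(i_1,\dots,i_r)} x_{i_1}x_{i_2}\cdots x_{i_r}\in\mathbb{Q}[\![\mathbf{x}]\!], \] where the sum is over all $(i_1,\dots,i_r)\in\mathbb{Z}^r$ such that $i_1\ge i_2\ge\cdots\ge i_r$, $i_k>i_{k+1}$ whenever $a_k>a_{k+1}$, and $i_k\le\mathrm{val}(a_k)$ for all $k$.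 A power series $f\in\mathbb{Q}[\![\mathbf{x}]\!]$ is called back quasisymmetric (or a back stable quasisymmetric function) if it has bounded degree, there is $N\in\mathbb{Z}$ such that no $x_i$ with $i>N$ appears in $f$, and there is $b\in\mathbb{Z}$ such that for every sequence of positive integers $(a_1,\dots,a_k)$ and every monomial $\mathsf{m}$ in the variables $x_i$ with $i>b$, the coefficients of $x_{i_1}^{a_1}\cdots x_{i_k}^{a_k}\mathsf{m}$ and of $x_{j_1}^{a_1}\cdots x_{j_k}^{a_k}\mathsf{m}$ in $f$ are equal whenever $i_1<\cdots<i_k\le b$ and $j_1<\cdots<j_k\le b$. Let $\overleftarrow{QR}$ be the $\mathbb{Q}$-vector space of back quasisymmetric functions. Theorem. The back stable slides $\overleftarrow{\mathfrak{F}}_{\mathbf{c}}$, for $\mathbf{c}$ ranging over all $\mathbb{N}$-vectors, form a $\mathbb{Q}$-basis of $\overleftarrow{QR}$. -/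

import Mathlib

namespace BackStable

/-- `ℕ`-vectors: finitely supported sequences of nonnegative integers indexed by `ℤ`. -/
abbrev NVector : Type := ℤ →₀ ℕ

/-- The ordered alphabet of letters `i⁽ʲ⁾` with `i : ℤ` and `j ≥ 1`, ordered lexicographically. -/
abbrev Letter : Type := ℤ ×ₗ ℕ+

/-- The value of the letter `i⁽ʲ⁾` is `i`. -/
def Letter.val (a : Letter) : ℤ := (ofLex a).1

/-- `f : P → ℤ` is a back stable `(P, Φ)`-partition. -/
structure IsBackStablePartition {P : Type*} [PartialOrder P] (Φ : P → Letter) (f : P → ℤ) :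
    Prop where
  weak : ∀ u v : P, u ⋖ v → f v ≤ f u
  strict : ∀ u v : P, u ⋖ v → Φ v < Φ u → f v < f u
  bounded : ∀ u : P, f u ≤ (Φ u).val

/-- The back stable `(P, Φ)`-partitions `f` whose monomial `∏ u, x_{f u}` is `x^m`. -/
def partitionsOfWeight {P : Type*} [PartialOrder P] [Fintype P] (Φ : P → Letter) (m : ℤ →₀ ℕ) :
    Set (P → ℤ) :=
  {f | IsBackStablePartition Φ f ∧ ∑ u, Finsupp.single (f u) 1 = m}

/-- Each monomial arises finitely often, so the cardinality below is the genuine one. -/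
theorem finite_partitionsOfWeight {P : Type*} [PartialOrder P] [Fintype P] (Φ : P → Letter)
    (m : ℤ →₀ ℕ) : (partitionsOfWeight Φ m).Finite := by
  classical
  refine (Set.Finite.pi' (t := fun _ : P => (m.support : Set ℤ))
    (fun _ => m.support.finite_toSet)).subset ?_
  rintro f ⟨-, hf⟩ u
  have h : Finsupp.single (f u) 1 ≤ m := by
    rw [← hf]
    exact Finset.single_le_sum (f := fun u => (Finsupp.single (f u) 1 : ℤ →₀ ℕ))
      (fun _ _ => zero_le) (Finset.mem_univ u)
  have h1 := h (f u)
  simp only [Finsupp.single_eq_same] at h1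
  simp only [Finset.mem_coe, Finsupp.mem_support_iff]
  omega

/-- The generating series `∑ f, ∏ u, x_{f u}` over all back stable `(P, Φ)`-partitions `f`. -/
noncomputable def partitionSeries {P : Type*} [PartialOrder P] [Fintype P] (Φ : P → Letter) :
    MvPowerSeries ℤ ℚ :=
  fun m => ((partitionsOfWeight Φ m).ncard : ℚ)

/-- The back stable slide of a word `W`: the generating series of the chain
`v₁ < v₂ < ⋯ < v_r` in which `v_k` is labeled by the `k`-th letter of `W`. -/
noncomputable def backSlideOfWord (W : List Letter) : MvPowerSeries ℤ ℚ :=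
  partitionSeries (P := Fin W.length) W.get

/-- The word `W_c`: the letters `i⁽ʲ⁾` with `1 ≤ j ≤ c i`, ordered with decreasing `i`, and
increasing `j` for fixed `i`. -/
def slideWord (c : NVector) : List Letter :=
  (c.support.sort (· ≥ ·)).flatMap fun i => (List.range (c i)).map fun j => toLex (i, j.succPNat)

/-- The back stable slide indexed by an `ℕ`-vector. -/
noncomputable def backSlide (c : NVector) : MvPowerSeries ℤ ℚ :=
  backSlideOfWord (slideWord c)

/-- `f` has bounded degree. -/
def HasBoundedDegree (f : MvPowerSeries ℤ ℚ) : Prop :=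
  ∃ d : ℕ, ∀ m : ℤ →₀ ℕ, MvPowerSeries.coeff m f ≠ 0 → m.degree ≤ d

/-- For some `N`, no variable `x_i` with `i > N` appears in `f`. -/
def HasBoundedVariables (f : MvPowerSeries ℤ ℚ) : Prop :=
  ∃ N : ℤ, ∀ m : ℤ →₀ ℕ, MvPowerSeries.coeff m f ≠ 0 → ∀ i : ℤ, N < i → m i = 0

/-- For every monomial `x^m` in the variables `x_i`, `i > b`, the coefficients of
`x_{i₁}^{a₁} ⋯ x_{i_k}^{a_k} x^m` and `x_{j₁}^{a₁} ⋯ x_{j_k}^{a_k} x^m` in `f` agree whenever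
`i₁ < ⋯ < i_k ≤ b` and `j₁ < ⋯ < j_k ≤ b`. -/
def QuasisymmetricUpTo (b : ℤ) (f : MvPowerSeries ℤ ℚ) : Prop :=
  ∀ (k : ℕ) (a : Fin k → ℕ), (∀ t, 0 < a t) →
    ∀ m : ℤ →₀ ℕ, (∀ i, i ≤ b → m i = 0) →
      ∀ i j : Fin k → ℤ, StrictMono i → StrictMono j → (∀ t, i t ≤ b) → (∀ t, j t ≤ b) →
        MvPowerSeries.coeff (∑ t, Finsupp.single (i t) (a t) + m) f =
          MvPowerSeries.coeff (∑ t, Finsupp.single (j t) (a t) + m) f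

/-- Back quasisymmetric functions. -/
structure IsBackQuasisymmetric (f : MvPowerSeries ℤ ℚ) : Prop where
  boundedDegree : HasBoundedDegree f
  boundedVariables : HasBoundedVariables f
  quasisymmetric : ∃ b : ℤ, QuasisymmetricUpTo b f

theorem strictMono_append {k l : ℕ} {i : Fin k → ℤ} {e : Fin l → ℤ} (hi : StrictMono i)
    (he : StrictMono e) (h : ∀ s t, i s < e t) : StrictMono (Fin.append i e) := by
  intro s t hst
  induction s using Fin.addCases with
  | left s =>
    induction t using Fin.addCases with
    | left t =>
      simp only [Fin.append_left]
      exact hi (by rw [Fin.lt_def] at hst ⊢; simpa only [Fin.val_castAdd] using hst)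
    | right t => simpa using h s t
  | right s =>
    induction t using Fin.addCases with
    | left t =>
      simp only [Fin.lt_def, Fin.val_natAdd, Fin.val_castAdd] at hst
      omega
    | right t =>
      simp only [Fin.append_right]
      exact he (by rw [Fin.lt_def] at hst ⊢; simp only [Fin.val_natAdd] at hst; omega)

theorem QuasisymmetricUpTo.mono {b b' : ℤ} {f : MvPowerSeries ℤ ℚ} (hf : QuasisymmetricUpTo b f)
    (hb : b' ≤ b) : QuasisymmetricUpTo b' f := by
  intro k a ha m hm i j hi hj hib hjb
  let m₁ := m.filter (· ≤ b)
  let m₂ := m.filter (fun x => ¬ x ≤ b)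
  have hm12 : m₁ + m₂ = m := Finsupp.filter_add_filter_not m _
  let e := m₁.support.orderEmbOfFin rfl
  have hmem : ∀ t, e t ∈ m₁.support := fun t => Finset.orderEmbOfFin_mem _ _ t
  have hsum : ∑ t, Finsupp.single (e t) (m₁ (e t)) = m₁ := by
    conv_rhs => rw [← Finsupp.sum_single m₁]
    rw [Finsupp.sum, ← Finset.sum_coe_sort m₁.support (fun x => Finsupp.single x (m₁ x))]
    exact Fintype.sum_equiv (m₁.support.orderIsoOfFin rfl).toEquiv _ _ (fun t => rfl)
  have heb : ∀ t, b' < e t ∧ e t ≤ b := by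
    intro t
    have h := hmem t
    simp only [m₁, Finsupp.support_filter, Finset.mem_filter, Finsupp.mem_support_iff] at h
    exact ⟨not_le.1 fun h' => h.1 (hm _ h'), h.2⟩
  have key : ∀ i : Fin k → ℤ, ∑ t, Finsupp.single (i t) (a t) + m =
      ∑ t, Finsupp.single (Fin.append i e t) (Fin.append a (fun s => m₁ (e s)) t) + m₂ := by
    intro i
    rw [Fin.sum_univ_add]
    simp only [Fin.append_left, Fin.append_right]
    rw [hsum, add_assoc, hm12]
  have hbd : ∀ i : Fin k → ℤ, (∀ t, i t ≤ b') → ∀ t, Fin.append i e t ≤ b := by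
    intro i hib t
    induction t using Fin.addCases with
    | left t => simpa using (hib t).trans hb
    | right t => simpa using (heb t).2
  rw [key i, key j]
  refine hf _ _ ?_ m₂ ?_ _ _
    (strictMono_append hi e.strictMono fun s t => (hib s).trans_lt (heb t).1)
    (strictMono_append hj e.strictMono fun s t => (hjb s).trans_lt (heb t).1)
    (hbd i hib) (hbd j hjb)
  · intro t
    induction t using Fin.addCases with
    | left t => simpa using ha t
    | right t => simpa using Nat.pos_of_ne_zero (Finsupp.mem_support_iff.1 (hmem t))
  · intro x hx
    simp [m₂, hx]

/-- The `ℚ`-vector space of back quasisymmetric functions. -/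
def backQuasisymmetric : Submodule ℚ (MvPowerSeries ℤ ℚ) where
  carrier := {f | IsBackQuasisymmetric f}
  zero_mem' := ⟨⟨0, by simp⟩, ⟨0, by simp⟩, ⟨0, by intro k a _ m _ i j; simp⟩⟩
  add_mem' := by
    rintro f g ⟨⟨d, hd⟩, ⟨N, hN⟩, ⟨b, hb⟩⟩ ⟨⟨d', hd'⟩, ⟨N', hN'⟩, ⟨b', hb'⟩⟩
    have hne : ∀ m, MvPowerSeries.coeff m (f + g) ≠ 0 →
        MvPowerSeries.coeff m f ≠ 0 ∨ MvPowerSeries.coeff m g ≠ 0 := by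
      intro m h
      by_contra! h'
      exact h (by rw [map_add, h'.1, h'.2, add_zero])
    refine ⟨⟨max d d', fun m hm => ?_⟩, ⟨max N N', fun m hm i hi => ?_⟩, ⟨min b b', ?_⟩⟩
    · exact (hne m hm).elim (fun h => (hd m h).trans (le_max_left _ _))
        (fun h => (hd' m h).trans (le_max_right _ _))
    · exact (hne m hm).elim (fun h => hN m h i ((le_max_left _ _).trans_lt hi))
        (fun h => hN' m h i ((le_max_right _ _).trans_lt hi))
    · intro k a ha m hm i j hi hj hib hjb
      rw [map_add, map_add,
        hb.mono (min_le_left b b') k a ha m hm i j hi hj hib hjb,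
        hb'.mono (min_le_right b b') k a ha m hm i j hi hj hib hjb]
  smul_mem' := by
    rintro r f ⟨⟨d, hd⟩, ⟨N, hN⟩, ⟨b, hb⟩⟩
    have hne : ∀ m, MvPowerSeries.coeff m (r • f) ≠ 0 → MvPowerSeries.coeff m f ≠ 0 := by
      intro m h h'
      exact h (by rw [MvPowerSeries.coeff_smul, h', mul_zero])
    refine ⟨⟨d, fun m hm => hd m (hne m hm)⟩, ⟨N, fun m hm => hN m (hne m hm)⟩, ⟨b, ?_⟩⟩
    intro k a ha m hm i j hi hj hib hjb
    rw [MvPowerSeries.coeff_smul, MvPowerSeries.coeff_smul, hb k a ha m hm i j hi hj hib hjb]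

end BackStable

namespace BackStable

open Finset

/-! Everything is read off from tail sums. A weakly decreasing sequence is determined by its weight,
so each monomial occurs in a slide at most once, and `coeff_backSlide` says when: `x^m` occurs in
the slide of `c` iff `m` and `c` have equal degree, `m` is dominated by `c` tail by tail, and every
tail sum of `c` is a tail sum of `m` (the forced strict descents). Hence the slides are
unitriangular for dominance (`eq_zero_of_coeff_sum_backSlide_eq_zero`), which gives independence.

For spanning, fix `b ≤ N` and `d`. A series of degree at most `d` in the `x_i`, `i ≤ N`,
quasisymmetric up to `b`, is determined by its coefficients at finitely many vectors packed below
`b`. The slides of these vectors lie in the same space, by `tail_le_of_packedBelow`. Their square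
coefficient matrix is injective by unitriangularity, hence surjective, so some combination of them
has the same packed coefficients as the given series and equals it. -/

/-! ### Tail sums and dominance. -/

/-- The sum of the entries of `c` at positions `≥ t`. -/
noncomputable def tail (t : ℤ) : NVector →+ ℕ :=
  Finsupp.liftAddHom fun i => if t ≤ i then AddMonoidHom.id ℕ else 0

theorem tail_single (t i : ℤ) (n : ℕ) : tail t (Finsupp.single i n) = if t ≤ i then n else 0 := by
  rw [tail, Finsupp.liftAddHom_apply_single]
  split_ifs <;> rfl

theorem tail_eq_sum (t : ℤ) (c : NVector) :
    tail t c = ∑ i ∈ c.support, if t ≤ i then c i else 0 := by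
  conv_lhs => rw [← Finsupp.sum_single c, Finsupp.sum, map_sum]
  exact Finset.sum_congr rfl fun i _ => tail_single t i _

theorem tail_succ (t : ℤ) (c : NVector) : tail t c = c t + tail (t + 1) c := by
  induction c using Finsupp.induction_linear with
  | zero => simp
  | add f g hf hg => rw [map_add, map_add, hf, hg, Finsupp.add_apply]; ring
  | single i n =>
    rw [tail_single, tail_single, Finsupp.single_apply]
    split_ifs <;> omega

theorem tail_antitone (c : NVector) : Antitone fun t => tail t c := by
  intro s t hst
  simp only [tail_eq_sum]
  refine Finset.sum_le_sum fun i _ => ?_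
  split_ifs <;> omega

theorem tail_eq_zero {t : ℤ} {c : NVector} (h : ∀ i, t ≤ i → c i = 0) : tail t c = 0 := by
  rw [tail_eq_sum]
  refine Finset.sum_eq_zero fun i _ => ?_
  split_ifs with hi
  exacts [h i hi, rfl]

theorem tail_eq_degree {t : ℤ} {c : NVector} (h : ∀ i, i < t → c i = 0) :
    tail t c = c.degree := by
  rw [tail_eq_sum, Finsupp.degree]
  refine Finset.sum_congr rfl fun i _ => ?_
  split_ifs with hi
  exacts [rfl, (h i (not_le.1 hi)).symm]

theorem tail_le_degree (t : ℤ) (c : NVector) : tail t c ≤ c.degree := by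
  rw [tail_eq_sum, Finsupp.degree]
  refine Finset.sum_le_sum fun i _ => ?_
  split_ifs <;> omega

theorem exists_tail_eq_zero (c : NVector) : ∃ t, tail t c = 0 := by
  obtain ⟨N, hN⟩ := c.support.finite_toSet.bddAbove
  refine ⟨N + 1, tail_eq_zero fun i hi => ?_⟩
  by_contra h
  have := hN (Finsupp.mem_support_iff.2 h)
  omega

theorem exists_forall_lt_eq_zero (c : NVector) : ∃ t, ∀ i, i < t → c i = 0 := by
  obtain ⟨N, hN⟩ := c.support.finite_toSet.bddBelow
  refine ⟨N, fun i hi => ?_⟩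
  by_contra h
  have := hN (Finsupp.mem_support_iff.2 h)
  omega

theorem exists_tail_eq_degree (c : NVector) : ∃ t, tail t c = c.degree :=
  (exists_forall_lt_eq_zero c).imp fun _ => tail_eq_degree

theorem eq_of_tail_eq {c c' : NVector} (h : ∀ t, tail t c = tail t c') : c = c' := by
  ext i
  have h1 := tail_succ i c
  have h2 := tail_succ i c'
  rw [h, h] at h1
  omega

/-- The condition under which the monomial `x^m` occurs in the back stable slide of `c`. -/
structure Refines (m c : NVector) : Prop where
  degree_eq : m.degree = c.degree
  tail_le : ∀ t, tail t m ≤ tail t c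
  exists_tail_eq : ∀ t, ∃ s, tail s m = tail t c

theorem Refines.refl (c : NVector) : Refines c c := ⟨rfl, fun _ => le_rfl, fun t => ⟨t, rfl⟩⟩

/-! ### Weakly decreasing sequences and their weights. -/

/-- The weight of a sequence of integers. -/
noncomputable def weight {r : ℕ} (f : Fin r → ℤ) : NVector := ∑ u, Finsupp.single (f u) 1

theorem degree_weight {r : ℕ} (f : Fin r → ℤ) : (weight f).degree = r := by
  simp [weight, map_sum]

theorem tail_weight {r : ℕ} (f : Fin r → ℤ) (t : ℤ) :
    tail t (weight f) = #{u | t ≤ f u} := by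
  simp [weight, map_sum, tail_single]

/-- An antitone sequence takes values `≥ t` exactly on an initial segment. -/
theorem le_iff_lt_tail_weight {r : ℕ} {f : Fin r → ℤ} (hf : Antitone f) (t : ℤ) (u : Fin r) :
    t ≤ f u ↔ (u : ℕ) < tail t (weight f) := by
  rw [tail_weight]
  constructor
  · intro h
    have : Finset.Iic u ⊆ ({u | t ≤ f u} : Finset (Fin r)) := fun v hv => by
      simpa using h.trans (hf (by simpa using hv))
    simpa using Finset.card_le_card this
  · intro h
    by_contra h'
    have : ({u | t ≤ f u} : Finset (Fin r)) ⊆ Finset.Iio u := fun v hv => by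
      simp only [Finset.mem_filter, Finset.mem_univ, true_and] at hv
      rw [Finset.mem_Iio]
      by_contra huv
      exact h' (hv.trans (hf (not_lt.1 huv)))
    have := Finset.card_le_card this
    rw [Fin.card_Iio] at this
    omega

theorem eq_of_weight_eq {r : ℕ} {f g : Fin r → ℤ} (hf : Antitone f) (hg : Antitone g)
    (h : weight f = weight g) : f = g := by
  funext u
  refine le_antisymm ?_ ?_
  · rw [le_iff_lt_tail_weight hg, ← h, ← le_iff_lt_tail_weight hf]
  · rw [le_iff_lt_tail_weight hf, h, ← le_iff_lt_tail_weight hg]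

theorem weight_get (l : List ℤ) : weight l.get = (l.map fun i => Finsupp.single i 1).sum := by
  rw [weight, ← List.sum_ofFn]
  congr 1
  conv_rhs => rw [← List.ofFn_get l, List.map_ofFn]
  rfl

theorem exists_antitone_weight_eq {r : ℕ} {m : NVector} (hm : m.degree = r) :
    ∃ f : Fin r → ℤ, Antitone f ∧ weight f = m := by
  let l := (Finsupp.toMultiset m).sort (· ≥ ·)
  have hw : weight l.get = m := by
    rw [weight_get, ← Multiset.sum_coe, ← Multiset.map_coe, Multiset.sort_eq]
    apply Multiset.toFinsupp.symm.injective
    change Finsupp.toMultiset _ = Finsupp.toMultiset m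
    rw [map_multiset_sum, Multiset.map_map]
    simp [Finsupp.toMultiset_single]
  have hl : l.length = r := by rw [← hm, ← degree_weight l.get, hw]
  subst hl
  exact ⟨l.get, (Multiset.pairwise_sort _ _).sortedGE.antitone_get, hw⟩

/-! ### Slide words and the monomials of a slide. -/

/-- The relation between any two letters of a slide word, in order of appearance. -/
theorem pairwise_slideWord (c : NVector) :
    (slideWord c).Pairwise fun a a' => a'.val < a.val ∨ (a'.val = a.val ∧ a < a') := by
  rw [slideWord, List.pairwise_flatMap]
  refine ⟨fun i _ => ?_, ?_⟩
  · rw [List.pairwise_map]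
    refine List.pairwise_lt_range.imp fun h => Or.inr ⟨rfl, ?_⟩
    rw [Prod.Lex.toLex_lt_toLex]
    exact Or.inr ⟨rfl, Nat.succPNat_lt_succPNat.2 h⟩
  · have h := (c.support.sortedGT_sort).pairwise
    refine h.imp fun {i j} hij a ha a' ha' => Or.inl ?_
    simp only [List.mem_map] at ha ha'
    obtain ⟨_, -, rfl⟩ := ha
    obtain ⟨_, -, rfl⟩ := ha'
    exact hij

/-- The values of the letters of `slideWord c`. -/
def slideValues (c : NVector) (u : Fin (slideWord c).length) : ℤ := ((slideWord c).get u).val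

theorem slideValues_antitone (c : NVector) : Antitone (slideValues c) := by
  intro u v huv
  rcases huv.eq_or_lt with rfl | h
  · exact le_rfl
  · rcases List.pairwise_iff_get.1 (pairwise_slideWord c) u v h with h | h
    exacts [h.le, h.1.le]

/-- Letters of equal value appear with increasing superscript, so the strictness condition is
triggered only by a drop in value. -/
theorem slideWord_get_lt_iff {c : NVector} {u v : Fin (slideWord c).length} (h : u < v) :
    (slideWord c).get v < (slideWord c).get u ↔ slideValues c v < slideValues c u := by
  rcases List.pairwise_iff_get.1 (pairwise_slideWord c) u v h with h | h
  · exact iff_of_true (Prod.Lex.lt_iff.2 (Or.inl h)) h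
  · exact iff_of_false h.2.not_gt h.1.not_lt

theorem weight_slideValues (c : NVector) : weight (slideValues c) = c := by
  have h : weight (slideValues c) =
      ((slideWord c).map fun a => Finsupp.single a.val 1).sum := by
    rw [weight, ← List.sum_ofFn]
    congr 1
    conv_rhs => rw [← List.ofFn_get (slideWord c), List.map_ofFn]
    rfl
  have hs : ∀ i, (((List.range (c i)).map fun j => (toLex (i, j.succPNat) : Letter)).map
      fun a : Letter => (Finsupp.single a.val 1 : NVector)).sum = Finsupp.single i (c i) := by
    intro i
    rw [List.map_map]
    have : ((fun a : Letter => (Finsupp.single a.val 1 : NVector)) ∘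
        fun j : ℕ => (toLex (i, j.succPNat) : Letter)) = fun _ => Finsupp.single i 1 := rfl
    rw [this]
    simp
  rw [h, slideWord, List.map_flatMap, List.flatMap_def, List.sum_flatten, List.map_map]
  have : (List.sum ∘ fun i => ((List.range (c i)).map
      fun j => (toLex (i, j.succPNat) : Letter)).map
      fun a : Letter => (Finsupp.single a.val 1 : NVector)) = fun i => Finsupp.single i (c i) := funext hs
  rw [this, ← Multiset.sum_coe, ← Multiset.map_coe, Finset.sort_eq]
  exact Finsupp.sum_single c

theorem length_slideWord (c : NVector) : (slideWord c).length = c.degree := by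
  rw [← degree_weight (slideValues c), weight_slideValues]

theorem refines_of_isBackStablePartition {c : NVector} {f : Fin (slideWord c).length → ℤ}
    (hf : Antitone f) (h : IsBackStablePartition (slideWord c).get f) : Refines (weight f) c := by
  refine ⟨by rw [degree_weight, length_slideWord], fun t => ?_, fun t => ?_⟩
  · conv_rhs => rw [← weight_slideValues c]
    rw [tail_weight, tail_weight]
    refine Finset.card_le_card fun u hu => ?_
    simp only [Finset.mem_filter, Finset.mem_univ, true_and] at hu ⊢
    exact hu.trans (h.bounded u)
  · rcases Nat.eq_zero_or_pos (tail t c) with h0 | h0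
    -- The extreme tail sums, zero and the full degree, are attained by any vector of that degree;
    -- only the others mark a descent inside the word.
    · rw [h0]
      exact exists_tail_eq_zero _
    rcases (tail_le_degree t c).eq_or_lt with hr | hr
    · obtain ⟨s, hs⟩ := exists_tail_eq_degree (weight f)
      exact ⟨s, by rw [hs, hr, degree_weight, length_slideWord]⟩
    obtain ⟨n, hn⟩ := Nat.exists_eq_add_of_lt h0
    rw [zero_add] at hn
    rw [← length_slideWord] at hr
    -- `u` is the last position with value at least `t` and `v` the next one; the forced drop from
    -- `f u` to `f v` makes exactly `n + 1` entries of `f` at least `f u`.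
    let u : Fin (slideWord c).length := ⟨n, by omega⟩
    let v : Fin (slideWord c).length := ⟨n + 1, by omega⟩
    have huv : u ⋖ v := by
      refine ⟨Fin.lt_def.2 (Nat.lt_succ_self n), fun w hw hw' => ?_⟩
      rw [Fin.lt_def] at hw hw'
      simp only [u, v] at hw hw'
      omega
    have hu := le_iff_lt_tail_weight (slideValues_antitone c) t u
    have hv := le_iff_lt_tail_weight (slideValues_antitone c) t v
    rw [weight_slideValues] at hu hv
    have hlt : slideValues c v < slideValues c u :=
      (not_le.1 (mt hv.1 (by simp only [v]; omega))).trans_le (hu.2 (by simp only [u]; omega))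
    have hlt' := h.strict u v huv ((slideWord_get_lt_iff huv.lt).2 hlt)
    refine ⟨f u, ?_⟩
    have h1 := (le_iff_lt_tail_weight hf (f u) u).1 le_rfl
    have h2 := mt (le_iff_lt_tail_weight hf (f u) v).2 (not_le.2 hlt')
    simp only [u, v] at h1 h2 ⊢
    omega

theorem isBackStablePartition_of_refines {c : NVector} {f : Fin (slideWord c).length → ℤ}
    (hf : Antitone f) (h : Refines (weight f) c) : IsBackStablePartition (slideWord c).get f := by
  refine ⟨fun u v huv => hf huv.le, fun u v huv hlt => ?_, fun u => ?_⟩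
  · rw [slideWord_get_lt_iff huv.lt] at hlt
    -- The threshold `s` cuts `f` where the value of `u` cuts the word, hence between `u` and `v`.
    obtain ⟨s, hs⟩ := h.exists_tail_eq (slideValues c u)
    have hu := (le_iff_lt_tail_weight (slideValues_antitone c) (slideValues c u) u).1 le_rfl
    have hv := mt (le_iff_lt_tail_weight (slideValues_antitone c) (slideValues c u) v).2
      (not_le.2 hlt)
    rw [weight_slideValues, ← hs, ← le_iff_lt_tail_weight hf] at hu hv
    exact (not_le.1 hv).trans_le hu
  · change f u ≤ slideValues c u
    rw [le_iff_lt_tail_weight (slideValues_antitone c), weight_slideValues]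
    exact ((le_iff_lt_tail_weight hf _ u).1 le_rfl).trans_le (h.tail_le _)

theorem IsBackStablePartition.antitone {r : ℕ} {Φ : Fin r → Letter} {f : Fin r → ℤ}
    (h : IsBackStablePartition Φ f) : Antitone f :=
  (antitone_iff_forall_covBy f).2 fun u v huv => h.weak u v huv

open scoped Classical in
/-- The back stable slides are multiplicity free, with monomials described by `Refines`. -/
theorem coeff_backSlide (c m : NVector) :
    MvPowerSeries.coeff m (backSlide c) = if Refines m c then 1 else 0 := by
  change ((partitionsOfWeight (slideWord c).get m).ncard : ℚ) = _
  split_ifs with h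
  · obtain ⟨f, hf, hw⟩ := exists_antitone_weight_eq (h.degree_eq.trans (length_slideWord c).symm)
    have : partitionsOfWeight (slideWord c).get m = {f} := by
      ext g
      constructor
      · rintro ⟨hg, hgw⟩
        exact eq_of_weight_eq hg.antitone hf (Eq.trans hgw hw.symm)
      · rintro rfl
        exact ⟨isBackStablePartition_of_refines hf (hw ▸ h), hw⟩
    rw [this, Set.ncard_singleton, Nat.cast_one]
  · have : partitionsOfWeight (slideWord c).get m = ∅ := by
      refine Set.eq_empty_of_forall_notMem ?_
      rintro g ⟨hg, rfl⟩
      exact h (refines_of_isBackStablePartition hg.antitone hg)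
    rw [this, Set.ncard_empty, Nat.cast_zero]

theorem refines_of_coeff_backSlide_ne_zero {c m : NVector}
    (h : MvPowerSeries.coeff m (backSlide c) ≠ 0) : Refines m c := by
  by_contra h'
  exact h (by rw [coeff_backSlide, if_neg h'])

/-! ### Linear independence. -/

/-- Unitriangularity of the back stable slides. -/
theorem eq_zero_of_coeff_sum_backSlide_eq_zero {S : Finset NVector} {l : NVector → ℚ}
    (h : ∀ c ∈ S, MvPowerSeries.coeff c (∑ c' ∈ S, l c' • backSlide c') = 0) :
    ∀ c ∈ S, l c = 0 := by
  classical
  by_contra! hne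
  obtain ⟨c₀, hc₀, hl₀⟩ := hne
  -- For `c` dominance-maximal among the vectors with nonzero coefficient, no other slide in the
  -- combination contains `x^c`.
  obtain ⟨c, hc, hmax⟩ := Finset.exists_maximalFor (fun (c : NVector) (t : ℤ) => tail t c)
    (S.filter fun c => l c ≠ 0) ⟨c₀, by simp [hc₀, hl₀]⟩
  rw [Finset.mem_filter] at hc
  refine hc.2 ?_
  have h0 := h c hc.1
  rw [map_sum, Finset.sum_eq_single_of_mem c hc.1] at h0
  · rwa [MvPowerSeries.coeff_smul, coeff_backSlide, if_pos (Refines.refl c), mul_one] at h0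
  · intro c' hc' hne
    rw [MvPowerSeries.coeff_smul, coeff_backSlide]
    split_ifs with hr
    · by_contra hl
      have hl : l c' ≠ 0 := left_ne_zero_of_mul hl
      have hle := hmax (j := c') (by simp [hc', hl]) fun t => hr.tail_le t
      exact hne (eq_of_tail_eq fun t => le_antisymm (hle t) (hr.tail_le t))
    · rw [mul_zero]

theorem linearIndependent_backSlide : LinearIndependent ℚ backSlide := by
  rw [linearIndependent_iff']
  exact fun S l hl => eq_zero_of_coeff_sum_backSlide_eq_zero fun c _ => by rw [hl, map_zero]

/-! ### Packed vectors and quasisymmetry of slides. -/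

/-- Below `b`, the support of `c` is an interval ending at `b`. -/
def PackedBelow (b : ℤ) (c : NVector) : Prop :=
  ∀ i j, i ≤ j → j ≤ b → c i ≠ 0 → c j ≠ 0

/-- For a packed vector, the dominance condition is only needed above `b`. -/
theorem tail_le_of_packedBelow {b : ℤ} {c m : NVector} (hc : PackedBelow b c)
    (hd : m.degree = c.degree) (hr : ∀ t, ∃ s, tail s m = tail t c)
    (hb : ∀ t, b < t → tail t m ≤ tail t c) (t : ℤ) : tail t m ≤ tail t c := by
  rcases lt_or_ge b t with h | h
  · exact hb t h
  have key : ∀ t, t ≤ b + 1 → tail t m ≤ tail t c := by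
    intro t ht
    induction t, ht using Int.leInductionDown with
    | base => exact hb _ (by omega)
    | pred n hn ih =>
      by_cases h0 : c (n - 1) = 0
      · have : tail (n - 1) c = c.degree := tail_eq_degree fun i hi => by
          by_contra h
          exact hc i (n - 1) hi.le (by omega) h h0
        rw [this, ← hd]
        exact tail_le_degree _ _
      · by_contra! hlt
        have h1 := tail_succ (n - 1) c
        rw [sub_add_cancel] at h1
        -- The value `tail (n - 1) c` would lie strictly between the consecutive tail sums of `m` at
        -- `n` and `n - 1`, so no `s` could attain it.
        obtain ⟨s, hs⟩ := hr (n - 1)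
        rcases le_or_gt n s with h | h
        · have : tail s m ≤ tail n m := tail_antitone m h
          omega
        · have : tail (n - 1) m ≤ tail s m := tail_antitone m (by omega)
          omega
  exact key t (by omega)

theorem tail_sum_single {k : ℕ} (i : Fin k → ℤ) (a : Fin k → ℕ) (t : ℤ) :
    tail t (∑ s, Finsupp.single (i s) (a s)) = ∑ s, if t ≤ i s then a s else 0 := by
  rw [map_sum]
  exact Finset.sum_congr rfl fun s _ => tail_single _ _ _

/-- Moving the part of a monomial below `b` does not change the set of its tail sums. -/
theorem exists_tail_eq_of_strictMono {k : ℕ} {a : Fin k → ℕ} {b : ℤ} {m : NVector}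
    (hm : ∀ i, i ≤ b → m i = 0) {i j : Fin k → ℤ} (hi : StrictMono i) (hj : StrictMono j)
    (hib : ∀ t, i t ≤ b) (hjb : ∀ t, j t ≤ b) (t : ℤ) :
    ∃ s, tail s (∑ t, Finsupp.single (j t) (a t) + m) =
      tail t (∑ t, Finsupp.single (i t) (a t) + m) := by
  simp only [map_add, tail_sum_single]
  by_cases h : ∃ u, t ≤ i u
  · obtain ⟨u, hu, hmin⟩ := WellFounded.has_min (wellFounded_lt (α := Fin k)) {u | t ≤ i u} h
    have hu : t ≤ i u := hu
    have hiff : ∀ v, j u ≤ j v ↔ t ≤ i v := fun v => by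
      rw [hj.le_iff_le]
      exact ⟨fun h => hu.trans (hi.monotone h), fun h => not_lt.1 (hmin v h)⟩
    -- `u` is the least index with `t ≤ i u`, so the threshold `j u` keeps the same exponents.
    refine ⟨j u, ?_⟩
    simp only [hiff]
    rw [tail_eq_degree fun x hx => hm x (hx.le.trans (hjb u)),
      tail_eq_degree fun x hx => hm x (hx.le.trans (hu.trans (hib u)))]
  · push Not at h
    -- No `i v` reaches `t`; raising the threshold past `b` discards every `j v` and loses nothing
    -- of `m`.
    refine ⟨max t (b + 1), ?_⟩
    congr 1
    · refine Finset.sum_congr rfl fun v _ => ?_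
      rw [if_neg, if_neg]
      · exact not_le.2 (h v)
      · have := hjb v
        have := le_max_right t (b + 1)
        omega
    · rcases le_total (b + 1) t with h' | h'
      · rw [max_eq_left h']
      · rw [max_eq_right h', tail_eq_degree fun x hx => hm x (by omega),
          tail_eq_degree fun x hx => hm x (by omega)]

theorem degree_sum_single_add {k : ℕ} (i : Fin k → ℤ) (a : Fin k → ℕ) (m : NVector) :
    (∑ t, Finsupp.single (i t) (a t) + m).degree = ∑ t, a t + m.degree := by
  simp [map_add, map_sum]

/-- Moving exponents below `b` changes neither the set of tail sums nor the tails beyond `b`;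
packedness of `c` supplies dominance at the remaining thresholds. -/
theorem Refines.of_strictMono {k : ℕ} {a : Fin k → ℕ} {b : ℤ} {m c : NVector}
    (hc : PackedBelow b c) (hm : ∀ i, i ≤ b → m i = 0) {i j : Fin k → ℤ} (hi : StrictMono i)
    (hj : StrictMono j) (hib : ∀ t, i t ≤ b) (hjb : ∀ t, j t ≤ b)
    (h : Refines (∑ t, Finsupp.single (i t) (a t) + m) c) :
    Refines (∑ t, Finsupp.single (j t) (a t) + m) c := by
  have hd : (∑ t, Finsupp.single (j t) (a t) + m).degree = c.degree := by
    rw [← h.degree_eq, degree_sum_single_add, degree_sum_single_add]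
  have hr : ∀ t, ∃ s, tail s (∑ t, Finsupp.single (j t) (a t) + m) = tail t c := by
    intro t
    obtain ⟨s, hs⟩ := h.exists_tail_eq t
    rw [← hs]
    exact exists_tail_eq_of_strictMono hm hi hj hib hjb s
  refine ⟨hd, tail_le_of_packedBelow hc hd hr fun t ht => ?_, hr⟩
  refine Eq.trans_le ?_ (h.tail_le t)
  simp only [map_add, tail_sum_single]
  congr 1
  refine Finset.sum_congr rfl fun v _ => ?_
  rw [if_neg (not_le.2 ((hjb v).trans_lt ht)), if_neg (not_le.2 ((hib v).trans_lt ht))]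

theorem quasisymmetricUpTo_backSlide {b : ℤ} {c : NVector} (hc : PackedBelow b c) :
    QuasisymmetricUpTo b (backSlide c) := by
  classical
  intro k a _ m hm i j hi hj hib hjb
  rw [coeff_backSlide, coeff_backSlide]
  exact if_congr ⟨.of_strictMono hc hm hi hj hib hjb, .of_strictMono hc hm hj hi hjb hib⟩ rfl rfl

/-! ### Bounded spaces of quasisymmetric series. -/

/-- Series of degree at most `d` in the variables `x_i`, `i ≤ N`, quasisymmetric up to `b`. -/
def boundedQuasisymmetric (b N : ℤ) (d : ℕ) : Submodule ℚ (MvPowerSeries ℤ ℚ) where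
  carrier := {f | QuasisymmetricUpTo b f ∧
    ∀ m : NVector, MvPowerSeries.coeff m f ≠ 0 → m.degree ≤ d ∧ ∀ i, N < i → m i = 0}
  zero_mem' := ⟨by intro k a _ m _ i j; simp, by simp⟩
  add_mem' := by
    rintro f g ⟨hf, hf'⟩ ⟨hg, hg'⟩
    refine ⟨?_, fun m hm => ?_⟩
    · intro k a ha m hm i j hi hj hib hjb
      rw [map_add, map_add, hf k a ha m hm i j hi hj hib hjb, hg k a ha m hm i j hi hj hib hjb]
    · by_cases h : MvPowerSeries.coeff m f = 0
      · exact hg' m fun h' => hm (by rw [map_add, h, h', add_zero])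
      · exact hf' m h
  smul_mem' := by
    rintro r f ⟨hf, hf'⟩
    refine ⟨?_, fun m hm => hf' m fun h => hm (by rw [MvPowerSeries.coeff_smul, h, mul_zero])⟩
    intro k a ha m hm i j hi hj hib hjb
    rw [MvPowerSeries.coeff_smul, MvPowerSeries.coeff_smul, hf k a ha m hm i j hi hj hib hjb]

theorem backSlide_mem_boundedQuasisymmetric {b N : ℤ} {d : ℕ} {c : NVector}
    (hc : PackedBelow b c) (hd : c.degree ≤ d) (hN : ∀ i, N < i → c i = 0) :
    backSlide c ∈ boundedQuasisymmetric b N d := by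
  refine ⟨quasisymmetricUpTo_backSlide hc, fun m hm => ?_⟩
  have h := refines_of_coeff_backSlide_ne_zero hm
  refine ⟨h.degree_eq.trans_le hd, fun i hi => ?_⟩
  have h1 := h.tail_le i
  rw [tail_eq_zero fun j hj => hN j (hi.trans_le hj)] at h1
  have := tail_succ i m
  omega

theorem isBackQuasisymmetric_of_mem {b N : ℤ} {d : ℕ} {f : MvPowerSeries ℤ ℚ}
    (hf : f ∈ boundedQuasisymmetric b N d) : IsBackQuasisymmetric f :=
  ⟨⟨d, fun m hm => (hf.2 m hm).1⟩, ⟨N, fun m hm => (hf.2 m hm).2⟩, ⟨b, hf.1⟩⟩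

theorem IsBackQuasisymmetric.exists_mem {f : MvPowerSeries ℤ ℚ} (hf : IsBackQuasisymmetric f) :
    ∃ b N d, b ≤ N ∧ f ∈ boundedQuasisymmetric b N d := by
  obtain ⟨⟨d, hd⟩, ⟨N, hN⟩, ⟨b, hb⟩⟩ := hf
  exact ⟨b, max b N, d, le_max_left _ _, hb, fun m hm =>
    ⟨hd m hm, fun i hi => hN m hm i ((le_max_right b N).trans_lt hi)⟩⟩

theorem backSlide_mem_backQuasisymmetric (c : NVector) : backSlide c ∈ backQuasisymmetric := by
  obtain ⟨t, ht⟩ := exists_forall_lt_eq_zero c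
  obtain ⟨N, hN⟩ := c.support.finite_toSet.bddAbove
  -- Below the support of `c`, packedness holds vacuously.
  refine isBackQuasisymmetric_of_mem (b := t - 1) (N := N) (d := c.degree)
    (backSlide_mem_boundedQuasisymmetric ?_ le_rfl fun i hi => ?_)
  · intro i j hij hj hi
    exact absurd (ht i (by omega)) hi
  · by_contra h
    have := hN (Finsupp.mem_support_iff.2 h)
    omega

/-! ### Reduction to finitely many packed coefficients. -/

theorem exists_strictMono_sum_single_eq (m : NVector) :
    ∃ (k : ℕ) (e : Fin k → ℤ) (a : Fin k → ℕ), StrictMono e ∧ (∀ t, 0 < a t) ∧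
      (∀ t, m (e t) ≠ 0) ∧ ∑ t, Finsupp.single (e t) (a t) = m := by
  let e := m.support.orderEmbOfFin rfl
  have hmem : ∀ t, m (e t) ≠ 0 := fun t =>
    Finsupp.mem_support_iff.1 (Finset.orderEmbOfFin_mem _ _ t)
  refine ⟨_, e, fun t => m (e t), e.strictMono, fun t => Nat.pos_of_ne_zero (hmem t), hmem, ?_⟩
  conv_rhs => rw [← Finsupp.sum_single m]
  rw [Finsupp.sum, ← Finset.sum_coe_sort m.support (fun x => Finsupp.single x (m x))]
  exact Fintype.sum_equiv (m.support.orderIsoOfFin rfl).toEquiv _ _ (fun t => rfl)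

/-- The coefficient at `x^m` of a series quasisymmetric up to `b` is one at a packed vector. -/
theorem exists_packedBelow_coeff_eq (b : ℤ) (m : NVector) :
    ∃ p : NVector, PackedBelow b p ∧ p.degree = m.degree ∧ (∀ i, b < i → p i = m i) ∧
      (∀ i, i ≤ b - p.degree → p i = 0) ∧ ∀ f : MvPowerSeries ℤ ℚ, QuasisymmetricUpTo b f →
        MvPowerSeries.coeff p f = MvPowerSeries.coeff m f := by
  obtain ⟨k, e, a, he, ha, hm, hsum⟩ := exists_strictMono_sum_single_eq (m.filter (· ≤ b))
  let m₂ := m.filter fun x => ¬ x ≤ b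
  have hm₂ : ∀ i, i ≤ b → m₂ i = 0 := fun i hi => by simp [m₂, hi]
  have hm12 : ∑ t, Finsupp.single (e t) (a t) + m₂ = m := by
    rw [hsum]
    exact Finsupp.filter_add_filter_not m _
  have heb : ∀ t, e t ≤ b := fun t => by
    by_contra h
    exact hm t (Finsupp.filter_apply_neg _ _ h)
  -- The `k` exponents at positions up to `b` are pushed into the `k` consecutive positions ending
  -- at `b`.
  let i : Fin k → ℤ := fun t => b - k + 1 + t
  have hi : StrictMono i := fun s t hst => by
    have : (s : ℕ) < t := hst
    simp only [i]
    omega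
  have hib : ∀ t, i t ≤ b := fun t => by simp only [i]; omega
  have hdeg : (∑ t, Finsupp.single (i t) (a t) + m₂).degree = m.degree := by
    rw [degree_sum_single_add, ← hm12, degree_sum_single_add]
  have hk : k ≤ m.degree := by
    rw [← hm12, degree_sum_single_add]
    calc k = ∑ _t : Fin k, 1 := by simp
      _ ≤ ∑ t, a t := Finset.sum_le_sum fun t _ => ha t
      _ ≤ _ := Nat.le_add_right _ _
  have happ : ∀ x, (∑ t, Finsupp.single (i t) (a t) + m₂) x =
      (∑ t, if i t = x then a t else 0) + m₂ x := fun x => by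
    simp [Finsupp.add_apply, Finsupp.finsetSum_apply, Finsupp.single_apply]
  have hlow : ∀ x, x ≤ b - k → (∑ t, Finsupp.single (i t) (a t) + m₂) x = 0 := fun x hx => by
    rw [happ, hm₂ x (by omega), add_zero]
    refine Finset.sum_eq_zero fun t _ => if_neg ?_
    simp only [i]
    omega
  refine ⟨∑ t, Finsupp.single (i t) (a t) + m₂, ?_, hdeg, fun x hx => ?_, fun x hx => ?_,
    fun f hf => ?_⟩
  · intro x y hxy hy hx
    have hx' : b - k < x := by
      by_contra h
      exact hx (hlow x (by omega))
    obtain ⟨n, hn⟩ := Int.eq_ofNat_of_zero_le (show 0 ≤ y - (b - k + 1) by omega)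
    let s : Fin k := ⟨n, by omega⟩
    have hs : i s = y := by simp only [i, s]; omega
    rw [happ]
    have : a s ≤ ∑ t, if i t = y then a t else 0 := by
      refine le_trans ?_ (Finset.single_le_sum (fun _ _ => Nat.zero_le _) (Finset.mem_univ s))
      rw [if_pos hs]
    have := ha s
    omega
  · rw [happ, Finset.sum_eq_zero, zero_add]
    · exact Finsupp.filter_apply_pos _ _ (not_le.2 hx)
    · exact fun t _ => if_neg ((hib t).trans_lt hx).ne
  · rw [hdeg] at hx
    exact hlow x (by omega)
  · rw [hf k a ha m₂ hm₂ i e hi he hib heb, hm12]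

theorem exists_finset_packedBelow (b N : ℤ) (d : ℕ) : ∃ P : Finset NVector, ∀ p, p ∈ P ↔
    PackedBelow b p ∧ p.degree ≤ d ∧ (∀ i, N < i → p i = 0) ∧ ∀ i, i ≤ b - d → p i = 0 := by
  classical
  let M : NVector := ∑ i ∈ Finset.Icc (b - d) N, Finsupp.single i d
  refine ⟨(Finset.Iic M).filter fun p => PackedBelow b p ∧ p.degree ≤ d ∧
    (∀ i, N < i → p i = 0) ∧ ∀ i, i ≤ b - d → p i = 0, fun p => ?_⟩
  rw [Finset.mem_filter, Finset.mem_Iic, and_iff_right_iff_imp]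
  rintro ⟨-, hd, hN, hl⟩ i
  by_cases hi : i ∈ Finset.Icc (b - d) N
  · have hM : M i = d := by
      simp only [M, Finsupp.finsetSum_apply, Finsupp.single_apply]
      rw [Finset.sum_ite_eq', if_pos hi]
    rw [hM]
    exact (Finsupp.le_degree i p).trans hd
  · rw [Finset.mem_Icc] at hi
    rcases lt_or_ge N i with h | h
    · rw [hN i h]
      exact Nat.zero_le _
    · rw [hl i (by omega)]
      exact Nat.zero_le _

/-- Packing a monomial of `f` preserves its coefficient and its degree. Since `b ≤ N`, the exponents
pushed up towards `b` stay within the allowed variables. -/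
theorem eq_zero_of_coeff_packedBelow_eq_zero {b N : ℤ} {d : ℕ} {f : MvPowerSeries ℤ ℚ}
    (hbN : b ≤ N) (hf : f ∈ boundedQuasisymmetric b N d)
    (h : ∀ p : NVector, PackedBelow b p → p.degree ≤ d → (∀ i, N < i → p i = 0) →
      (∀ i, i ≤ b - d → p i = 0) → MvPowerSeries.coeff p f = 0) : f = 0 := by
  ext m
  rw [map_zero]
  by_contra hm
  obtain ⟨hd, hN⟩ := hf.2 m hm
  obtain ⟨p, hp, hpd, hpm, hl, hc⟩ := exists_packedBelow_coeff_eq b m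
  rw [← hc f hf.1] at hm
  refine hm (h p hp (hpd.trans_le hd) (fun i hi => ?_) fun i hi => hl i (by omega))
  rw [hpm i (hbN.trans_lt hi), hN i hi]

/-! ### Spanning and the basis. -/

theorem mem_span_backSlide {f : MvPowerSeries ℤ ℚ} (hf : IsBackQuasisymmetric f) :
    f ∈ Submodule.span ℚ (Set.range backSlide) := by
  classical
  obtain ⟨b, N, d, hbN, hf⟩ := hf.exists_mem
  obtain ⟨P, hP⟩ := exists_finset_packedBelow b N d
  let F : (P → ℚ) →ₗ[ℚ] MvPowerSeries ℤ ℚ := Fintype.linearCombination ℚ fun p : P => backSlide p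
  -- The square matrix of coefficients of the packed slides at the packed monomials.
  let T : (P → ℚ) →ₗ[ℚ] (P → ℚ) :=
    (LinearMap.pi fun p : P => MvPowerSeries.coeff (R := ℚ) (p : NVector)) ∘ₗ F
  have hT : Function.Injective T := by
    rw [← LinearMap.ker_eq_bot, LinearMap.ker_eq_bot']
    intro l hl
    let l' : NVector → ℚ := fun c => if h : c ∈ P then l ⟨c, h⟩ else 0
    have hFl : F l = ∑ c ∈ P, l' c • backSlide c := by
      rw [← Finset.sum_coe_sort P]
      simp only [F, Fintype.linearCombination_apply]
      exact Finset.sum_congr rfl fun p _ => by simp [l']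
    have h0 := eq_zero_of_coeff_sum_backSlide_eq_zero (S := P) (l := l') fun c hc => by
      rw [← hFl]
      exact congrFun hl ⟨c, hc⟩
    funext p
    simpa [l'] using h0 p p.2
  obtain ⟨l, hl⟩ := LinearMap.injective_iff_surjective.1 hT
    fun p => MvPowerSeries.coeff (p : NVector) f
  have hFl : F l ∈ boundedQuasisymmetric b N d := by
    simp only [F, Fintype.linearCombination_apply]
    refine Submodule.sum_mem _ fun p _ => Submodule.smul_mem _ _ ?_
    obtain ⟨h1, h2, h3, -⟩ := (hP p).1 p.2
    exact backSlide_mem_boundedQuasisymmetric h1 h2 h3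
  have heq : f = F l := by
    rw [← sub_eq_zero]
    refine eq_zero_of_coeff_packedBelow_eq_zero hbN (Submodule.sub_mem _ hf hFl)
      fun p h1 h2 h3 h4 => ?_
    rw [map_sub, sub_eq_zero]
    exact (congrFun hl ⟨p, (hP p).2 ⟨h1, h2, h3, h4⟩⟩).symm
  rw [heq]
  simp only [F, Fintype.linearCombination_apply]
  exact Submodule.sum_mem _ fun p _ =>
    Submodule.smul_mem _ _ (Submodule.subset_span ⟨(p : NVector), rfl⟩)

end BackStable

theorem mainTheorem2 :
    ∃ B : Module.Basis BackStable.NVector ℚ BackStable.backQuasisymmetric,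
      ∀ c : BackStable.NVector, (B c : MvPowerSeries ℤ ℚ) = BackStable.backSlide c := by
  let v : BackStable.NVector → BackStable.backQuasisymmetric := fun c =>
    ⟨BackStable.backSlide c, BackStable.backSlide_mem_backQuasisymmetric c⟩
  have hli : LinearIndependent ℚ v :=
    LinearIndependent.of_comp BackStable.backQuasisymmetric.subtype
      BackStable.linearIndependent_backSlide
  have hsp : ⊤ ≤ Submodule.span ℚ (Set.range v) := by
    rintro ⟨f, hf⟩ -
    have h := BackStable.mem_span_backSlide hf
    have hr : Set.range BackStable.backSlide =
        BackStable.backQuasisymmetric.subtype '' Set.range v := by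
      rw [← Set.range_comp]
      rfl
    -- Membership in the ambient span descends to the submodule because the inclusion is injective.
    rw [hr, Submodule.span_image] at h
    obtain ⟨g, hg, hgf⟩ := h
    rwa [← show g = ⟨f, hf⟩ from Subtype.ext hgf]
  exact ⟨Module.Basis.mk hli hsp, fun c => by rw [Module.Basis.mk_apply]⟩
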